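/- Let $Q^m=\{[z]\in\mathbb{C}P^{m+1} : z_1^2+\dots+z_{m+2}^2=0\}$, $m\ge 3$, be the complex quadric with the Kähler structure $(J,G)$ induced by the Fubini–Study metric of $\mathbb{C}P^{m+1}$ (normalized so that the Hopf fibration $S^{2m+3}\to\mathbb{C}P^{m+1}$ from the unit sphere is a Riemannian submersion). Let $M$ be a real hypersurface of $Q^m$, that is, a smooth immersed submanifold of real dimension $2m-1$, with induced metric $g$ and Levi-Civita connection $\nabla$. For a local unit normal field $N$ let $S$ be the shape operator, $\xi=-JN$ the Reeb vector field, $\eta(X)=g(X,\xi)$, and let $\phi X$ be the tangential part of $JX$. $M$ is called Hopf if $S\xi=\alpha\xi$ for some function $\alpha$ on $M$. The structure Lie operator $L_\xi$ is defined by $$g(L_\xi X,Y)=(\mathcal{L}_\xi g)(X,Y)=g(\nabla_X\xi,Y)+g(X,\nabla_Y\xi).$$ For a real number $k\neq 0$ put $$F^{(k)}_XY=g(\phi SX,Y)\xi-\eta(Y)\phi SX-k\,\eta(X)\phi Y,\qquad T^{(k)}_XY=F^{(k)}_XY-F^{(k)}_YX,$$ $$L_{\xi_T}^{(k)}(X,Y)=T^{(k)}_XL_\xi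 Y-L_\xi T^{(k)}_XY$$ for $X,Y$ tangent to $M$. Theorem 1.4. Let $m\ge 3$ and let $k$ be a nonzero real number. There does not exist any non-Hopf real hypersurface $M$ in $Q^m$ such that $L_{\xi_T}^{(k)}(\xi,X)=0$ for all $X$ tangent to $M$. -/

import Mathlib

open scoped Manifold ContDiff ComplexConjugate InnerProductSpace

noncomputable section

namespace ComplexQuadric

/-! ### The complex quadric -/

/-- The space `ℂ^{m+2}` of homogeneous coordinates, with its standard Hermitian inner product. -/
abbrev Coord (m : ℕ) : Type := EuclideanSpace ℂ (Fin (m + 2))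

/-- The conjugate vector `z̄`. -/
def conjVec {m : ℕ} (z : Coord m) : Coord m :=
  WithLp.toLp 2 fun i => conj (z i)

/-- The complex quadric `Q^m ⊂ ℂP^{m+1}`, given by `z₁² + ⋯ + z_{m+2}² = 0`. -/
def quadric (m : ℕ) : Set (Projectivization ℂ (Coord m)) :=
  {q | ∀ z ∈ q.submodule, ∑ i, z i ^ 2 = 0}

/-- For a unit vector `z` with `[z] ∈ Q^m`, the space `ℂ^{m+2} ⊖ ([z] ⊕ [z̄])`. It consists of the
horizontal lifts to `z` of the tangent vectors of `Q^m` at `[z]`, for the Hopf fibration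
`S^{2m+3} → ℂP^{m+1}`, `z ↦ [z]`. The Fubini–Study metric is the metric for which this fibration is
a Riemannian submersion, so on lifts the Kähler metric of `Q^m` is `Re ⟪·, ·⟫`, and the complex
structure `J` is multiplication by `i`. -/
def tangentLift {m : ℕ} (z : Coord m) : Submodule ℂ (Coord m) :=
  (Submodule.span ℂ {z, conjVec z})ᗮ

/-- The orthogonal projection of `ℂ^{m+2}` onto `ℂ^{m+2} ⊖ ([z] ⊕ [z̄])`, as a real linear map. -/
def projQ {m : ℕ} (z : Coord m) : Coord m →ₗ[ℝ] Coord m :=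
  ((tangentLift z).starProjection.toLinearMap).restrictScalars ℝ

/-! ### Real hypersurfaces -/

section Hypersurface

variable {m : ℕ} {M : Type*} [TopologicalSpace M]
  [ChartedSpace (EuclideanSpace ℝ (Fin (2 * m - 1))) M]

/-- The tangent space `T_pM` of a manifold of dimension `2m - 1`. -/
abbrev Tan (m : ℕ) {M : Type*} [TopologicalSpace M]
    [ChartedSpace (EuclideanSpace ℝ (Fin (2 * m - 1))) M] (p : M) : Type :=
  TangentSpace (𝓡 (2 * m - 1)) p

/-- The derivative at `p` of a vector valued function on `M`. -/
def vecDeriv (V : M → Coord m) (p : M) : Tan m p →ₗ[ℝ] Coord m :=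
  (mfderiv (𝓡 (2 * m - 1)) 𝓘(ℝ, Coord m) V p).toLinearMap

/-- `z` is, on the open set `U`, a smooth lift of `f : M → ℂP^{m+1}` to the unit sphere
`S^{2m+3} ⊂ ℂ^{m+2}`. -/
structure IsLift (f : M → Projectivization ℂ (Coord m)) (U : Set M) (z : M → Coord m) : Prop where
  isOpen : IsOpen U
  smooth : ContMDiffOn (𝓡 (2 * m - 1)) 𝓘(ℝ, Coord m) ∞ z U
  norm_eq_one : ∀ x ∈ U, ‖z x‖ = 1
  mem_line : ∀ x ∈ U, z x ∈ (f x).submodule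

/-- The differential of `f = [z]` at `p`: it sends `X ∈ T_pM` to the horizontal lift of
`df(X) ∈ T_{f(p)}Q^m` to `z(p)`, which is the horizontal part of `dz(X)`. -/
def differential (z : M → Coord m) (p : M) : Tan m p →ₗ[ℝ] Coord m :=
  projQ (z p) ∘ₗ vecDeriv z p

/-- `f : M → ℂP^{m+1}` is a smooth immersion of the `(2m-1)`-dimensional manifold `M` with values in
`Q^m`, that is, `M` is a real hypersurface of `Q^m`. A map into `ℂP^{m+1}` is smooth if and only if
it has smooth lifts to the unit sphere near every point. -/
structure IsRealHypersurface (f : M → Projectivization ℂ (Coord m)) : Prop where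
  mem_quadric : ∀ x, f x ∈ quadric m
  smooth : ∀ p, ∃ (U : Set M) (z : M → Coord m), IsLift f U z ∧ p ∈ U
  immersion : ∀ (U : Set M) (z : M → Coord m), IsLift f U z →
    ∀ p ∈ U, Function.Injective (differential z p)

/-- A smooth unit normal vector field `N` of `M` in `Q^m`, defined on the open set `U`: the vector
`N x ∈ T_{f(x)}Q^m` is given by its horizontal lift `ν x` to the unit vector `z x`, where `z` is a
smooth lift of `f` on `U`. -/
structure LocalUnitNormal (f : M → Projectivization ℂ (Coord m)) where
  U : Set M
  z : M → Coord m
  ν : M → Coord m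
  isLift : IsLift f U z
  smooth : ContMDiffOn (𝓡 (2 * m - 1)) 𝓘(ℝ, Coord m) ∞ ν U
  tangent : ∀ x ∈ U, ν x ∈ tangentLift (z x)
  norm_eq_one : ∀ x ∈ U, ‖ν x‖ = 1
  normal : ∀ x ∈ U, ∀ X : Tan m x, (⟪ν x, differential z x X⟫_ℂ).re = 0

namespace LocalUnitNormal

variable {f : M → Projectivization ℂ (Coord m)} (N : LocalUnitNormal f) (p : M)

/-- The differential of `f` at `p`, in terms of horizontal lifts to `z p`. -/
abbrev df : Tan m p →ₗ[ℝ] Coord m := differential N.z p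

/-- The tangent part of a vector `w` of `T_{f(p)}Q^m` (given by its horizontal lift):
the vector `X ∈ T_pM` with `df(X) = w - G(w, N) N`. -/
def tangentPart : Coord m →ₗ[ℝ] Tan m p :=
  (N.df p).leftInverse ∘ₗ
    (LinearMap.id - (Complex.reLm ∘ₗ ((innerSL ℂ (N.ν p)).toLinearMap.restrictScalars ℝ)).smulRight
      (N.ν p))

/-- The induced Riemannian metric `g(X, Y) = G(df X, df Y)` on `T_pM`. -/
def metric : Tan m p →ₗ[ℝ] Tan m p →ₗ[ℝ] ℝ :=
  LinearMap.mk₂ ℝ (fun X Y => (⟪N.df p X, N.df p Y⟫_ℂ).re)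
    (fun X X' Y => by simp)
    (fun c X Y => by
      rw [map_smul, ← Complex.coe_smul, inner_smul_left]; simp)
    (fun X Y Y' => by simp)
    (fun c X Y => by
      rw [map_smul, ← Complex.coe_smul, inner_smul_right]; simp)

/-- The Levi-Civita connection `∇̄` of `Q^m` along `f`: `X ↦ ∇̄_X V` for a vector field `V` along `f`
given by horizontal lifts `V x` to `z x`. Since the Hopf fibration is a Riemannian submersion,
`∇̄_X V` is the projection of the Euclidean derivative of `V` along the horizontal lift of `X`.
The lift `z` moves with velocity `dz(X)`, whose vertical part is `⟪z, dz(X)⟫ z`; as lifts satisfy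
`V(e^{it} z) = e^{it} V(z)`, the derivative along the horizontal part of `dz(X)` is
`dV(X) - ⟪z, dz(X)⟫ V`. -/
def ambientConnection (V : M → Coord m) : Tan m p →ₗ[ℝ] Coord m :=
  projQ (N.z p) ∘ₗ
    (vecDeriv V p -
      ((LinearMap.toSpanSingleton ℂ (Coord m) (V p)).restrictScalars ℝ ∘ₗ
        (innerSL ℂ (N.z p)).toLinearMap.restrictScalars ℝ ∘ₗ vecDeriv N.z p))

/-- The Levi-Civita connection of the induced metric on `M`: `X ↦ ∇_X Y` is the tangent part of
`∇̄_X Y` (Gauss formula). -/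
def connection (Y : ∀ x : M, Tan m x) : Tan m p →ₗ[ℝ] Tan m p :=
  N.tangentPart p ∘ₗ N.ambientConnection p fun x => N.df x (Y x)

/-- The shape operator `S` of `M` with respect to `N`: `S X` is the tangent vector with
`df(S X) = -∇̄_X N` (Weingarten formula). -/
def shape : Tan m p →ₗ[ℝ] Tan m p :=
  -(N.tangentPart p ∘ₗ N.ambientConnection p N.ν)

/-- The Reeb vector field `ξ = -J N`. -/
def reeb : Tan m p :=
  N.tangentPart p (-(Complex.I • N.ν p))

/-- The `1`-form `η(X) = g(X, ξ)`. -/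
def eta (X : Tan m p) : ℝ :=
  N.metric p X (N.reeb p)

/-- The structure tensor: `φ X` is the tangent part of `J X`. -/
def phi : Tan m p →ₗ[ℝ] Tan m p :=
  N.tangentPart p ∘ₗ
    (LinearMap.lsmul ℂ (Coord m) Complex.I).restrictScalars ℝ ∘ₗ N.df p

/-- The Lie derivative `(𝓛_ξ g)(X, Y) = g(∇_X ξ, Y) + g(X, ∇_Y ξ)` of the metric along the Reeb
vector field, as a linear form in `Y`. -/
def lieMetric (X : Tan m p) : Tan m p →ₗ[ℝ] ℝ :=
  N.metric p (N.connection p N.reeb X) + N.metric p X ∘ₗ N.connection p N.reeb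

/-- The structure Lie operator `L_ξ`: `L_ξ X` is the vector with
`g(L_ξ X, Y) = (𝓛_ξ g)(X, Y)` for all `Y`. -/
def structureLie (X : Tan m p) : Tan m p :=
  (N.metric p).leftInverse (N.lieMetric p X)

/-- The `k`-th Cho operator
`F_X^{(k)} Y = g(φ S X, Y) ξ - η(Y) φ S X - k η(X) φ Y`. -/
def cho (k : ℝ) (X Y : Tan m p) : Tan m p :=
  N.metric p (N.phi p (N.shape p X)) Y • N.reeb p - N.eta p Y • N.phi p (N.shape p X)
    - (k * N.eta p X) • N.phi p Y

/-- The `k`-th torsion operator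
`T_X^{(k)} Y = F_X^{(k)} Y - F_Y^{(k)} X`. -/
def torsion (k : ℝ) (X Y : Tan m p) : Tan m p :=
  N.cho p k X Y - N.cho p k Y X

/-- The tensor field `L_{ξ_T}^{(k)}(X, Y) = T_X^{(k)} L_ξ Y - L_ξ T_X^{(k)} Y`. -/
def lieTorsion (k : ℝ) (X Y : Tan m p) : Tan m p :=
  N.torsion p k X (N.structureLie p Y) - N.structureLie p (N.torsion p k X Y)

end LocalUnitNormal

/-- `M` is Hopf: at every point, `S ξ = α ξ` for some real `α`, where `S` and `ξ` are taken with
respect to a unit normal vector field near the point. (Such a field is unique up to sign near the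
point, and replacing `N` by `-N` replaces `S`, `ξ` by `-S`, `-ξ`.) -/
def IsHopf (f : M → Projectivization ℂ (Coord m)) : Prop :=
  ∀ p : M, ∃ N : LocalUnitNormal f, p ∈ N.U ∧ ∃ α : ℝ, N.shape p (N.reeb p) = α • N.reeb p

/-- `L_{ξ_T}^{(k)}(ξ, X) = 0` for all `X` tangent to `M`: every point lies in the domain of a unit
normal vector field with respect to which this holds at the point. -/
def LieTorsionVanishes (f : M → Projectivization ℂ (Coord m)) (k : ℝ) : Prop :=
  ∀ p : M, ∃ N : LocalUnitNormal f, p ∈ N.U ∧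
    ∀ X : Tan m p, N.lieTorsion p k (N.reeb p) X = 0

end Hypersurface

end ComplexQuadric

end

open scoped Manifold ContDiff InnerProductSpace

namespace ComplexQuadric

/-! ### Linear algebra of horizontal lifts. -/

section TangentLift

variable {m : ℕ}

/-! The argument is pointwise and tests the condition only on `X = ξ`. Since `T_ξ ξ = 0` by
antisymmetry, it reduces to `T_ξ (L_ξ ξ) = 0`. From `∇_X ξ = φ S X` (`connection_reeb`) and `η ∘ φ =
0` (`eta_phi`) one gets `L_ξ ξ = φ S ξ` (`structureLie_reeb`), while the `ξ`-component of `T_ξ X` is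
`g(φ S ξ, X)` (`eta_torsion_reeb`). Hence `|φ S ξ|² = 0`, and `ker φ = ℝ ξ` makes `S ξ` a multiple
of `ξ`: the hypersurface is Hopf. -/

lemma real_inner_eq_re (v w : Coord m) : ⟪v, w⟫_ℝ = (⟪v, w⟫_ℂ).re := by
  simp [PiLp.inner_apply]

lemma inner_conjVec_self {z : Coord m} (hz : ∑ i, z i ^ 2 = 0) : ⟪conjVec z, z⟫_ℂ = 0 := by
  rw [← hz, PiLp.inner_apply]
  refine Finset.sum_congr rfl fun i _ => ?_
  simp [conjVec, sq]

lemma conjVec_ne_zero {z : Coord m} (hz : z ≠ 0) : conjVec z ≠ 0 := by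
  contrapose! hz
  ext i
  simpa [conjVec] using congrArg (fun w : Coord m => w i) hz

/-- At points of the quadric, `ℂ^{m+2} ⊖ ([z] ⊕ [z̄])` has real dimension `2m`. -/
lemma finrank_tangentLift {z : Coord m} (h0 : z ≠ 0) (hz : ∑ i, z i ^ 2 = 0) :
    Module.finrank ℝ (tangentLift z) = 2 * m := by
  -- The quadric equation says exactly that `z` and `z̄` are Hermitian orthogonal.
  have hli : LinearIndependent ℂ ![z, conjVec z] := by
    refine linearIndependent_of_ne_zero_of_inner_eq_zero (𝕜 := ℂ) ?_ ?_
    · intro i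
      fin_cases i
      · exact h0
      · exact conjVec_ne_zero h0
    · intro i j hij
      fin_cases i <;> fin_cases j
      · exact absurd rfl hij
      · exact inner_eq_zero_symm.mp (inner_conjVec_self hz)
      · exact inner_conjVec_self hz
      · exact absurd rfl hij
  have hspan : Module.finrank ℂ (Submodule.span ℂ {z, conjVec z}) = 2 := by
    have h := finrank_span_eq_card hli
    rwa [Matrix.range_cons, Matrix.range_cons, Matrix.range_empty, Set.union_empty,
      Fintype.card_fin] at h
  have hsum := Submodule.finrank_add_finrank_orthogonal (Submodule.span ℂ {z, conjVec z})
  rw [hspan, finrank_euclideanSpace_fin] at hsum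
  have : Module.finrank ℂ (tangentLift z) = m := by
    unfold tangentLift
    omega
  rw [finrank_real_of_complex, this]

lemma projQ_mem (z w : Coord m) : projQ z w ∈ tangentLift z :=
  (tangentLift z).starProjection_apply_mem w

lemma projQ_smul (z w : Coord m) (c : ℂ) : projQ z (c • w) = c • projQ z w :=
  map_smul (tangentLift z).starProjection c w

lemma inner_projQ {z v : Coord m} (hv : v ∈ tangentLift z) (w : Coord m) :
    ⟪v, projQ z w⟫_ℂ = ⟪v, w⟫_ℂ := by
  change ⟪v, (tangentLift z).starProjection w⟫_ℂ = _
  rw [← Submodule.inner_starProjection_left_eq_right,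
    Submodule.starProjection_eq_self_iff.mpr hv]

end TangentLift

/-! ### Derivatives of vector fields. -/

section Hypersurface

variable {m : ℕ} {M : Type*} [TopologicalSpace M]
  [ChartedSpace (EuclideanSpace ℝ (Fin (2 * m - 1))) M]

lemma vecDeriv_congr {V W : M → Coord m} {p : M} (h : V =ᶠ[nhds p] W) :
    vecDeriv V p = vecDeriv W p := by
  ext1 X
  exact DFunLike.congr_fun (F := EuclideanSpace ℝ (Fin (2 * m - 1)) →L[ℝ] Coord m) h.mfderiv_eq X

/-- The derivative of a vector field of constant length is orthogonal to the field. -/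
lemma re_inner_vecDeriv_eq_zero {V : M → Coord m} {U : Set M} (hU : IsOpen U)
    (hV : ContMDiffOn (𝓡 (2 * m - 1)) 𝓘(ℝ, Coord m) ∞ V U) (h1 : ∀ x ∈ U, ‖V x‖ = 1)
    {p : M} (hp : p ∈ U) (X : Tan m p) : (⟪V p, vecDeriv V p X⟫_ℂ).re = 0 := by
  have hd : MDifferentiableAt (𝓡 (2 * m - 1)) 𝓘(ℝ, Coord m) V p :=
    (hV.contMDiffAt (hU.mem_nhds hp)).mdifferentiableAt (by simp)
  -- Differentiate `‖V‖²` twice over: by the chain rule, and as a locally constant function.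
  have hn := (hasStrictFDerivAt_norm_sq (V p)).hasFDerivAt.hasMFDerivAt.comp p hd.hasMFDerivAt
  have hc : HasMFDerivAt (𝓡 (2 * m - 1)) 𝓘(ℝ, ℝ) ((fun x : Coord m => ‖x‖ ^ 2) ∘ V) p
      (0 : TangentSpace (𝓡 (2 * m - 1)) p →L[ℝ] ℝ) := by
    refine (hasMFDerivAt_const (1 : ℝ) p).congr_of_eventuallyEq ?_
    filter_upwards [hU.mem_nhds hp] with x hx
    simp [h1 x hx]
  have h := DFunLike.congr_fun (hasMFDerivAt_unique hn hc) X
  have h2 : (2 : ℝ) * (⟪V p, vecDeriv V p X⟫_ℂ).re = 0 := by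
    have h3 : (2 : ℝ) * ⟪V p, vecDeriv V p X⟫_ℝ = 0 := by
      rw [← smul_eq_mul, ofNat_smul_eq_nsmul ℝ 2]
      exact h
    rwa [real_inner_eq_re] at h3
  linarith

namespace LocalUnitNormal

variable {f : M → Projectivization ℂ (Coord m)} (N : LocalUnitNormal f) {p : M}

/-! ### Tangent space and unit normal. -/

lemma df_mem (X : Tan m p) : N.df p X ∈ tangentLift (N.z p) := projQ_mem _ _

variable (hf : IsRealHypersurface f) (hp : p ∈ N.U)

include hp in
lemma inner_normal_self : ⟪N.ν p, N.ν p⟫_ℂ = 1 := by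
  rw [inner_self_eq_norm_sq_to_K, N.norm_eq_one p hp]
  simp


include hf hp in
lemma df_injective : Function.Injective (N.df p) :=
  hf.immersion N.U N.z N.isLift p hp

include hf hp in
/-- The differential maps `T_pM` onto the orthogonal complement of the normal in `T_{f(p)}Q^m`. -/
lemma exists_df_eq (hm : 1 ≤ m) {w : Coord m} (hw : w ∈ tangentLift (N.z p))
    (hn : (⟪N.ν p, w⟫_ℂ).re = 0) : ∃ X : Tan m p, N.df p X = w := by
  -- Adjoining the normal line gives an injective map between spaces of real dimension `2m`, so it
  -- is onto.
  let ψ : Tan m p × ℝ →ₗ[ℝ] Coord m :=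
    (N.df p).coprod (LinearMap.toSpanSingleton ℝ (Coord m) (N.ν p))
  have hψ : ∀ a, ψ a = N.df p a.1 + a.2 • N.ν p := fun a => rfl
  have hre : ∀ a, (⟪N.ν p, ψ a⟫_ℂ).re = a.2 := by
    intro a
    rw [hψ, inner_add_right, Complex.add_re, N.normal p hp, ← Complex.coe_smul, inner_smul_right,
      N.inner_normal_self hp]
    simp
  have hinj : Function.Injective ψ := by
    refine (injective_iff_map_eq_zero ψ).mpr fun a ha => ?_
    have h2 : a.2 = 0 := by rw [← hre a, ha]; simp
    have h1 : N.df p a.1 = 0 := by simpa [hψ, h2] using ha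
    exact Prod.ext ((injective_iff_map_eq_zero _).mp (N.df_injective hf hp) _ h1) h2
  have hz : N.z p ≠ 0 := fun h => by simpa [h] using N.isLift.norm_eq_one p hp
  have hq : ∑ i, N.z p i ^ 2 = 0 := hf.mem_quadric p _ (N.isLift.mem_line p hp)
  have hTan : Module.finrank ℝ (Tan m p) = 2 * m - 1 :=
    finrank_euclideanSpace_fin (𝕜 := ℝ) (n := 2 * m - 1)
  have : FiniteDimensional ℝ (Tan m p) :=
    inferInstanceAs (FiniteDimensional ℝ (EuclideanSpace ℝ (Fin (2 * m - 1))))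
  have hrange : LinearMap.range ψ = (tangentLift (N.z p)).restrictScalars ℝ := by
    refine Submodule.eq_of_le_of_finrank_eq ?_ ?_
    · rintro _ ⟨a, rfl⟩
      exact add_mem (N.df_mem a.1)
        (((tangentLift (N.z p)).restrictScalars ℝ).smul_mem a.2 (N.tangent p hp))
    · rw [LinearMap.finrank_range_of_inj hinj, Module.finrank_prod, hTan, Module.finrank_self]
      refine Eq.trans ?_ (finrank_tangentLift hz hq).symm
      -- `1 ≤ m` keeps the subtraction in `2 * m - 1` from truncating.
      omega
  obtain ⟨a, rfl⟩ : w ∈ LinearMap.range ψ := hrange ▸ hw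
  refine ⟨a.1, ?_⟩
  rw [hre] at hn
  simp [hψ, hn]

lemma tangentPart_apply (w : Coord m) :
    N.tangentPart p w = (N.df p).leftInverse (w - (⟪N.ν p, w⟫_ℂ).re • N.ν p) := rfl

include hf hp in
-- `leftInverse` inverts `df` only on its range; `exists_df_eq` puts the right-hand side there.
lemma df_tangentPart (hm : 1 ≤ m) {w : Coord m} (hw : w ∈ tangentLift (N.z p)) :
    N.df p (N.tangentPart p w) = w - (⟪N.ν p, w⟫_ℂ).re • N.ν p := by
  obtain ⟨X, hX⟩ := N.exists_df_eq hf hp hm (w := w - (⟪N.ν p, w⟫_ℂ).re • N.ν p)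
    (sub_mem hw (((tangentLift (N.z p)).restrictScalars ℝ).smul_mem _ (N.tangent p hp))) (by
      rw [inner_sub_right, ← Complex.coe_smul, inner_smul_right, N.inner_normal_self hp]
      simp)
  rw [tangentPart_apply, ← hX,
    LinearMap.leftInverse_apply_of_inj (LinearMap.ker_eq_bot.mpr (N.df_injective hf hp))]

include hp in
lemma tangentPart_normal : N.tangentPart p (N.ν p) = 0 := by
  rw [tangentPart_apply, N.inner_normal_self hp]
  simp

include hp in
lemma re_inner_normal_I_smul (c : ℝ) : (⟪N.ν p, c • (Complex.I • N.ν p)⟫_ℂ).re = 0 := by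
  rw [← Complex.coe_smul, inner_smul_right, inner_smul_right, N.inner_normal_self hp]
  simp

include hf hp in
lemma df_reeb (hm : 1 ≤ m) : N.df p (N.reeb p) = -(Complex.I • N.ν p) := by
  have h := N.re_inner_normal_I_smul hp (-1)
  rw [neg_one_smul] at h
  rw [reeb, N.df_tangentPart hf hp hm
    (neg_mem ((tangentLift _).smul_mem _ (N.tangent p hp))), h]
  simp

/-! ### Algebra of the metric, `φ`, `ξ` and `η`. -/

lemma phi_apply (X : Tan m p) : N.phi p X = N.tangentPart p (Complex.I • N.df p X) := rfl

lemma metric_apply (X Y : Tan m p) : N.metric p X Y = (⟪N.df p X, N.df p Y⟫_ℂ).re := rfl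

lemma metric_comm (X Y : Tan m p) : N.metric p X Y = N.metric p Y X := by
  rw [metric_apply, metric_apply, ← inner_conj_symm, Complex.conj_re]

include hf hp in
lemma metric_self_eq_zero {X : Tan m p} (h : N.metric p X X = 0) : X = 0 := by
  rw [metric_apply] at h
  have h0 : N.df p X = 0 := (inner_self_eq_zero (𝕜 := ℂ)).mp <| by
    rw [← inner_self_ofReal_re]
    simpa using h
  exact (injective_iff_map_eq_zero _).mp (N.df_injective hf hp) X h0

include hf hp in
lemma ker_metric : LinearMap.ker (N.metric p) = ⊥ := by
  refine LinearMap.ker_eq_bot'.mpr fun X hX => N.metric_self_eq_zero hf hp ?_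
  rw [hX]
  rfl

include hf hp in
lemma eta_reeb (hm : 1 ≤ m) : N.eta p (N.reeb p) = 1 := by
  rw [eta, metric_apply, N.df_reeb hf hp hm, inner_neg_neg, inner_smul_left, inner_smul_right,
    N.inner_normal_self hp]
  simp

include hf hp in
lemma phi_reeb (hm : 1 ≤ m) : N.phi p (N.reeb p) = 0 := by
  rw [phi_apply, N.df_reeb hf hp hm, smul_neg, smul_smul, Complex.I_mul_I, neg_one_smul, neg_neg,
    N.tangentPart_normal hp]

include hf hp in
-- `G(JX, -JN) = -G(X, N) = 0`, and the normal part removed from `JX` is orthogonal to `JN`.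
lemma eta_phi (hm : 1 ≤ m) (X : Tan m p) : N.eta p (N.phi p X) = 0 := by
  have h1 : (⟪N.df p X, N.ν p⟫_ℂ).re = 0 := by
    rw [← inner_conj_symm, Complex.conj_re]
    exact N.normal p hp X
  have h2 : ∀ c : ℝ, (⟪c • N.ν p, Complex.I • N.ν p⟫_ℂ).re = 0 := fun c => by
    rw [← Complex.coe_smul, inner_smul_left, inner_smul_right, N.inner_normal_self hp]
    simp
  rw [eta, metric_apply, phi_apply, N.df_reeb hf hp hm,
    N.df_tangentPart hf hp hm ((tangentLift _).smul_mem _ (N.df_mem X)), inner_neg_right,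
    inner_sub_left, Complex.neg_re, Complex.sub_re, h2, inner_smul_left, inner_smul_right,
    ← mul_assoc]
  simp [h1]

/-! ### Connection and shape operator. -/

lemma ambientConnection_apply (V : M → Coord m) (X : Tan m p) :
    N.ambientConnection p V X =
      projQ (N.z p) (vecDeriv V p X - ⟪N.z p, vecDeriv N.z p X⟫_ℂ • V p) := rfl

lemma ambientConnection_mem (V : M → Coord m) (X : Tan m p) :
    N.ambientConnection p V X ∈ tangentLift (N.z p) := projQ_mem _ _

include hp in
-- Constancy of `‖ν‖` kills the derivative term, constancy of `‖z‖` the vertical correction.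
lemma re_inner_ambientConnection_normal (X : Tan m p) :
    (⟪N.ν p, N.ambientConnection p N.ν X⟫_ℂ).re = 0 := by
  rw [ambientConnection_apply, inner_projQ (N.tangent p hp), inner_sub_right, inner_smul_right,
    N.inner_normal_self hp, mul_one, Complex.sub_re,
    re_inner_vecDeriv_eq_zero N.isLift.isOpen N.smooth N.norm_eq_one hp,
    re_inner_vecDeriv_eq_zero N.isLift.isOpen N.isLift.smooth N.isLift.norm_eq_one hp, sub_zero]

include hf hp in
lemma df_shape (hm : 1 ≤ m) (X : Tan m p) :
    N.df p (N.shape p X) = -N.ambientConnection p N.ν X := by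
  have h : N.shape p X = -N.tangentPart p (N.ambientConnection p N.ν X) := rfl
  rw [h, map_neg, N.df_tangentPart hf hp hm (N.ambientConnection_mem _ X),
    N.re_inner_ambientConnection_normal hp, zero_smul, sub_zero]

include hp in
-- The Kähler identity `∇̄J = 0`, applied to `N`: multiplication by `i` commutes with
-- differentiation, projection and the vertical correction.
lemma ambientConnection_I_smul_normal (X : Tan m p) :
    N.ambientConnection p (fun x => -(Complex.I • N.ν x)) X =
      -(Complex.I • N.ambientConnection p N.ν X) := by
  have hd : MDifferentiableAt (𝓡 (2 * m - 1)) 𝓘(ℝ, Coord m) N.ν p :=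
    (N.smooth.contMDiffAt (N.isLift.isOpen.mem_nhds hp)).mdifferentiableAt (by simp)
  let L : Coord m →L[ℝ] Coord m := -(Complex.I • ContinuousLinearMap.id ℝ (Coord m))
  have hL : HasMFDerivAt (𝓡 (2 * m - 1)) 𝓘(ℝ, Coord m) (fun x => -(Complex.I • N.ν x)) p _ :=
    (L.hasFDerivAt (x := N.ν p)).hasMFDerivAt.comp p hd.hasMFDerivAt
  have hv : vecDeriv (fun x => -(Complex.I • N.ν x)) p X = -(Complex.I • vecDeriv N.ν p X) := by
    rw [vecDeriv, hL.mfderiv]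
    rfl
  rw [ambientConnection_apply, ambientConnection_apply, hv, ← neg_smul, ← neg_smul, ← neg_smul,
    ← projQ_smul, smul_sub, smul_comm]

include hf hp in
/-- `∇_X ξ = φ S X`. -/
lemma connection_reeb (hm : 1 ≤ m) (X : Tan m p) :
    N.connection p N.reeb X = N.phi p (N.shape p X) := by
  -- `df ξ = -JN` is known only on `N.U`, so the fields are compared as germs at `p`.
  have hev : (fun x => N.df x (N.reeb x)) =ᶠ[nhds p] fun x => -(Complex.I • N.ν x) := by
    filter_upwards [N.isLift.isOpen.mem_nhds hp] with x hx using N.df_reeb hf hx hm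
  have h : N.ambientConnection p (fun x => N.df x (N.reeb x)) X =
      N.ambientConnection p (fun x => -(Complex.I • N.ν x)) X := by
    rw [ambientConnection_apply, ambientConnection_apply, vecDeriv_congr hev, hev.eq_of_nhds]
  rw [phi_apply, N.df_shape hf hp hm, smul_neg, ← N.ambientConnection_I_smul_normal hp, ← h]
  rfl

/-! ### The structure Lie and torsion operators at `ξ`. -/

include hf hp in
/-- `L_ξ ξ = φ S ξ`. -/
lemma structureLie_reeb (hm : 1 ≤ m) :
    N.structureLie p (N.reeb p) = N.phi p (N.shape p (N.reeb p)) := by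
  have h : N.lieMetric p (N.reeb p) = N.metric p (N.phi p (N.shape p (N.reeb p))) := by
    ext Y
    change N.metric p (N.connection p N.reeb (N.reeb p)) Y +
      N.metric p (N.reeb p) (N.connection p N.reeb Y) = _
    rw [N.connection_reeb hf hp hm, N.connection_reeb hf hp hm, metric_comm _ (N.reeb p)]
    -- The second term is `η(φ S Y) = 0`.
    exact add_eq_left.mpr (N.eta_phi hf hp hm _)
  rw [structureLie, h, LinearMap.leftInverse_apply_of_inj (N.ker_metric hf hp)]

lemma structureLie_zero : N.structureLie p 0 = 0 := by
  have h : N.lieMetric p 0 = 0 := by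
    ext Y
    simp [lieMetric]
  rw [structureLie, h, map_zero]

lemma eta_sub (X Y : Tan m p) : N.eta p (X - Y) = N.eta p X - N.eta p Y := by
  simp [eta]

lemma eta_smul (c : ℝ) (X : Tan m p) : N.eta p (c • X) = c * N.eta p X := by
  simp [eta]

include hf hp in
/-- `g(T_ξ X, ξ) = g(φ S ξ, X)`. -/
lemma eta_torsion_reeb (hm : 1 ≤ m) (k : ℝ) (X : Tan m p) :
    N.eta p (N.torsion p k (N.reeb p) X) = N.metric p (N.phi p (N.shape p (N.reeb p))) X := by
  have h : N.metric p (N.phi p (N.shape p X)) (N.reeb p) = 0 := N.eta_phi hf hp hm _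
  -- All terms but one, including those with `k`, are multiples of some `φ Z` or vanish by `h`.
  simp only [torsion, cho, eta_sub, eta_smul, N.eta_reeb hf hp hm, N.eta_phi hf hp hm, h]
  ring

include hf hp in
/-- If `φ X = 0`, then `X` is a multiple of `ξ`. -/
lemma eq_smul_reeb_of_phi_eq_zero (hm : 1 ≤ m) {X : Tan m p} (h : N.phi p X = 0) :
    ∃ a : ℝ, X = a • N.reeb p := by
  have h1 := N.df_tangentPart hf hp hm ((tangentLift _).smul_mem Complex.I (N.df_mem X))
  rw [← phi_apply, h, map_zero, eq_comm, sub_eq_zero] at h1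
  -- `JX` is normal, so applying `-J` recovers `X`, with coefficient `G(N, JX) = η(X)`.
  refine ⟨(⟪N.ν p, Complex.I • N.df p X⟫_ℂ).re, N.df_injective hf hp ?_⟩
  rw [map_smul, N.df_reeb hf hp hm, smul_neg, smul_comm, ← h1, smul_smul, Complex.I_mul_I,
    neg_one_smul, neg_neg]

include hf hp in
/-- Evaluating the `ξ`-component of `T_ξ L_ξ ξ = L_ξ T_ξ ξ = 0` gives `|φ S ξ|² = 0`. -/
lemma shape_reeb_of_lieTorsion_eq_zero (hm : 1 ≤ m) {k : ℝ}
    (h : N.lieTorsion p k (N.reeb p) (N.reeb p) = 0) :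
    ∃ α : ℝ, N.shape p (N.reeb p) = α • N.reeb p := by
  refine N.eq_smul_reeb_of_phi_eq_zero hf hp hm (N.metric_self_eq_zero hf hp ?_)
  have h0 : N.torsion p k (N.reeb p) (N.reeb p) = 0 := sub_self _
  rw [lieTorsion, h0, structureLie_zero, sub_zero, N.structureLie_reeb hf hp hm] at h
  rw [← N.eta_torsion_reeb hf hp hm k, h]
  simp [eta]

end LocalUnitNormal

end Hypersurface

end ComplexQuadric

theorem theorem1p4 (m : ℕ) (hm : 3 ≤ m) (k : ℝ) (hk : k ≠ 0)
    (M : Type*) [TopologicalSpace M] [ChartedSpace (EuclideanSpace ℝ (Fin (2 * m - 1))) M]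
    [IsManifold (𝓡 (2 * m - 1)) ∞ M]
    (f : M → Projectivization ℂ (ComplexQuadric.Coord m))
    (hf : ComplexQuadric.IsRealHypersurface f) :
    ¬ (¬ ComplexQuadric.IsHopf f ∧ ComplexQuadric.LieTorsionVanishes f k) := by
  rintro ⟨hnot, hvan⟩
  refine hnot fun p => ?_
  obtain ⟨N, hp, hN⟩ := hvan p
  exact ⟨N, hp, N.shape_reeb_of_lieTorsion_eq_zero hf hp (by omega) (hN _)⟩
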